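/- Work with short partizan games under misère play (a player who is to move and cannot move wins). For games $G,H$ write $G\ge H$ if $o(G+X)\ge o(H+X)$ for every short game $X$, where $o$ is the misère outcome, outcomes are ordered in Left's favour, and $+$ is the disjunctive sum; write $G=H$ if $G\ge H$ and $H\ge G$. A \emph{Left dead end} is a game none of whose subpositions (including itself) has a Left option. The Left dead ends, modulo $=$, form a commutative monoid $\mathcal L$ under $+$; an \emph{atom} of $\mathcal L$ is a non-invertible element $a\in\mathcal L$ such that whenever $a=b+c$ with $b,c\in\mathcal L$, at least one of $b,c$ is invertible in $\mathcal L$. A (Right) option $G'$ of a Left dead end $G$ is \emph{good} if there is no option $G''$ of $G$ with $G'>G''$. Let $\overline 0=\{\cdot\mid\cdot\}$ and $\overline{n+1}=\{\cdot\mid\overline n\}$ for $n\ge 0$. \textbf{Proposition.} Let $n\ge 0$ be an integer. If a Left dead end $G$ has a good option equal to $\overline n$, then $G=\overline{n+1}$ or $G$ is an atom of $\mathcal L$ (or both). -/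

import Mathlib

namespace MisereGame

/-- Forms of short partizan games: a form has finitely many Left options and finitely many Right
options, each of them a form. -/
inductive ShortGame : Type
  | mk (a b : ℕ) (L : Fin a → ShortGame) (R : Fin b → ShortGame) : ShortGame

namespace ShortGame

/-- `G'` is a Left option of `G`. -/
def IsLeftOption (G' : ShortGame) : ShortGame → Prop
  | mk _ _ L _ => ∃ i, G' = L i

/-- `G'` is a Right option of `G`. -/
def IsRightOption (G' : ShortGame) : ShortGame → Prop
  | mk _ _ _ R => ∃ j, G' = R j

/-- `G'` is an option (of either player) of `G`. -/
def IsOption (G' G : ShortGame) : Prop := IsLeftOption G' G ∨ IsRightOption G' G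

/-- `H` is a subposition of `G`: it is reached from `G` by finitely many (possibly zero) moves,
not necessarily alternating. -/
def IsSubposition (H G : ShortGame) : Prop := Relation.ReflTransGen IsOption H G

/-- A Left end: a form with no Left option. -/
def IsLeftEnd (G : ShortGame) : Prop := ∀ G', ¬ IsLeftOption G' G

/-- A Left dead end: a form all of whose subpositions (itself included) are Left ends. -/
def IsLeftDeadEnd (G : ShortGame) : Prop := ∀ H, IsSubposition H G → IsLeftEnd H

/-- The empty game `{· | ·}`. -/
instance : Zero ShortGame := ⟨mk 0 0 Fin.elim0 Fin.elim0⟩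

/-- Disjunctive sum, see `mk_add_mk` for its defining equation. -/
noncomputable def add (G : ShortGame) : ShortGame → ShortGame :=
  ShortGame.rec (motive := fun _ => ShortGame → ShortGame)
    (fun a b _ _ ihL ihR H =>
      ShortGame.rec (motive := fun _ => ShortGame)
        (fun c d L' R' ihL' ihR' =>
          mk (a + c) (b + d)
            (Fin.append (fun i => ihL i (mk c d L' R')) ihL')
            (Fin.append (fun i => ihR i (mk c d L' R')) ihR')) H) G

noncomputable instance : Add ShortGame := ⟨add⟩

theorem mk_add_mk (a b c d : ℕ) (L : Fin a → ShortGame) (R : Fin b → ShortGame)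
    (L' : Fin c → ShortGame) (R' : Fin d → ShortGame) :
    mk a b L R + mk c d L' R' =
      mk (a + c) (b + d)
        (Fin.append (fun i => L i + mk c d L' R') (fun i => mk a b L R + L' i))
        (Fin.append (fun j => R j + mk c d L' R') (fun j => mk a b L R + R' j)) := rfl

/-- The integer `n̄`: `0` if `n = 0`, and `{· | (n-1)‾}` otherwise. -/
def integer : ℕ → ShortGame
  | 0 => 0
  | n + 1 => mk 0 1 Fin.elim0 (fun _ => integer n)

mutual
/-- Under misère play, Left wins when Left moves first: either Left cannot move, or Left has a
move after which Right, now to move, does not win. -/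
def LeftWinsFirst : ShortGame → Prop
  | mk a _ L _ => a = 0 ∨ ∃ i : Fin a, ¬ RightWinsFirst (L i)
/-- Under misère play, Right wins when Right moves first. -/
def RightWinsFirst : ShortGame → Prop
  | mk _ b _ R => b = 0 ∨ ∃ j : Fin b, ¬ LeftWinsFirst (R j)
end

/-- The misère outcome: (Left wins moving first, Left wins moving second). With the product order
on `Prop × Prop` the four outcome classes form the usual diamond `ℛ < 𝒩, 𝒫 < ℒ`. -/
def outcome (G : ShortGame) : Prop × Prop := (LeftWinsFirst G, ¬ RightWinsFirst G)

/-- The order modulo full misère: `G ≥ H` if `o(G + X) ≥ o(H + X)` for every short game `X`. -/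
instance : Preorder ShortGame where
  le H G := ∀ X : ShortGame, outcome (H + X) ≤ outcome (G + X)
  le_refl _ _ := le_rfl
  le_trans _ _ _ h₁ h₂ X := (h₁ X).trans (h₂ X)

/-- `G'` is a good option of `G`: a Left option not strictly dominated by another Left option, or
a Right option not strictly dominated by another Right option. (Left prefers greater options,
Right smaller ones.) -/
def IsGoodOption (G' G : ShortGame) : Prop :=
  (IsLeftOption G' G ∧ ¬ ∃ G'', IsLeftOption G'' G ∧ G' < G'') ∨
  (IsRightOption G' G ∧ ¬ ∃ G'', IsRightOption G'' G ∧ G'' < G')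

/-! ### The monoid structure

`Same` (isomorphism of forms, i.e. identity up to order and repetition of options) is used only to
verify the monoid laws. -/

/-- Isomorphism of forms. -/
def Same : ShortGame → ShortGame → Prop
  | mk _ _ L R, mk _ _ L' R' =>
    ((∀ i, ∃ j, Same (L i) (L' j)) ∧ (∀ j, ∃ i, Same (L i) (L' j))) ∧
    ((∀ i, ∃ j, Same (R i) (R' j)) ∧ (∀ j, ∃ i, Same (R i) (R' j)))

theorem isLeftOption_add {K G H : ShortGame} : IsLeftOption K (G + H) ↔
    (∃ G', IsLeftOption G' G ∧ K = G' + H) ∨ (∃ H', IsLeftOption H' H ∧ K = G + H') := by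
  obtain ⟨a, b, L, R⟩ := G
  obtain ⟨c, d, L', R'⟩ := H
  rw [mk_add_mk]
  simp only [IsLeftOption]
  constructor
  · rintro ⟨i, rfl⟩
    refine Fin.addCases (fun i => ?_) (fun i => ?_) i
    · exact Or.inl ⟨_, ⟨i, rfl⟩, by rw [Fin.append_left]⟩
    · exact Or.inr ⟨_, ⟨i, rfl⟩, by rw [Fin.append_right]⟩
  · rintro (⟨_, ⟨i, rfl⟩, rfl⟩ | ⟨_, ⟨i, rfl⟩, rfl⟩)
    · exact ⟨Fin.castAdd c i, by rw [Fin.append_left]⟩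
    · exact ⟨Fin.natAdd a i, by rw [Fin.append_right]⟩

theorem isRightOption_add {K G H : ShortGame} : IsRightOption K (G + H) ↔
    (∃ G', IsRightOption G' G ∧ K = G' + H) ∨ (∃ H', IsRightOption H' H ∧ K = G + H') := by
  obtain ⟨a, b, L, R⟩ := G
  obtain ⟨c, d, L', R'⟩ := H
  rw [mk_add_mk]
  simp only [IsRightOption]
  constructor
  · rintro ⟨i, rfl⟩
    refine Fin.addCases (fun i => ?_) (fun i => ?_) i
    · exact Or.inl ⟨_, ⟨i, rfl⟩, by rw [Fin.append_left]⟩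
    · exact Or.inr ⟨_, ⟨i, rfl⟩, by rw [Fin.append_right]⟩
  · rintro (⟨_, ⟨i, rfl⟩, rfl⟩ | ⟨_, ⟨i, rfl⟩, rfl⟩)
    · exact ⟨Fin.castAdd d i, by rw [Fin.append_left]⟩
    · exact ⟨Fin.natAdd b i, by rw [Fin.append_right]⟩

/-- Induction on options. -/
theorem option_induction {p : ShortGame → Prop}
    (h : ∀ G, (∀ G', IsLeftOption G' G → p G') → (∀ G', IsRightOption G' G → p G') → p G)
    (G : ShortGame) : p G := by
  induction G with
  | mk a b L R ihL ihR =>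
    refine h _ ?_ ?_
    · rintro _ ⟨i, rfl⟩; exact ihL i
    · rintro _ ⟨i, rfl⟩; exact ihR i

theorem same_iff {G H : ShortGame} : Same G H ↔
    ((∀ G', IsLeftOption G' G → ∃ H', IsLeftOption H' H ∧ Same G' H') ∧
      (∀ H', IsLeftOption H' H → ∃ G', IsLeftOption G' G ∧ Same G' H')) ∧
    ((∀ G', IsRightOption G' G → ∃ H', IsRightOption H' H ∧ Same G' H') ∧
      (∀ H', IsRightOption H' H → ∃ G', IsRightOption G' G ∧ Same G' H')) := by
  obtain ⟨a, b, L, R⟩ := G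
  obtain ⟨c, d, L', R'⟩ := H
  simp only [IsLeftOption, IsRightOption]
  rw [Same]
  constructor
  · rintro ⟨⟨h1, h2⟩, h3, h4⟩
    refine ⟨⟨?_, ?_⟩, ?_, ?_⟩
    · rintro _ ⟨i, rfl⟩; obtain ⟨j, hj⟩ := h1 i; exact ⟨_, ⟨j, rfl⟩, hj⟩
    · rintro _ ⟨i, rfl⟩; obtain ⟨j, hj⟩ := h2 i; exact ⟨_, ⟨j, rfl⟩, hj⟩
    · rintro _ ⟨i, rfl⟩; obtain ⟨j, hj⟩ := h3 i; exact ⟨_, ⟨j, rfl⟩, hj⟩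
    · rintro _ ⟨i, rfl⟩; obtain ⟨j, hj⟩ := h4 i; exact ⟨_, ⟨j, rfl⟩, hj⟩
  · rintro ⟨⟨h1, h2⟩, h3, h4⟩
    refine ⟨⟨?_, ?_⟩, ?_, ?_⟩
    · intro i; obtain ⟨_, ⟨j, rfl⟩, hj⟩ := h1 _ ⟨i, rfl⟩; exact ⟨j, hj⟩
    · intro i; obtain ⟨_, ⟨j, rfl⟩, hj⟩ := h2 _ ⟨i, rfl⟩; exact ⟨j, hj⟩
    · intro i; obtain ⟨_, ⟨j, rfl⟩, hj⟩ := h3 _ ⟨i, rfl⟩; exact ⟨j, hj⟩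
    · intro i; obtain ⟨_, ⟨j, rfl⟩, hj⟩ := h4 _ ⟨i, rfl⟩; exact ⟨j, hj⟩

theorem leftWinsFirst_iff {G : ShortGame} : LeftWinsFirst G ↔
    (∀ G', ¬ IsLeftOption G' G) ∨ ∃ G', IsLeftOption G' G ∧ ¬ RightWinsFirst G' := by
  obtain ⟨a, b, L, R⟩ := G
  rw [LeftWinsFirst]
  refine or_congr ⟨?_, ?_⟩ ⟨?_, ?_⟩
  · rintro rfl _ ⟨i, _⟩; exact i.elim0
  · intro h; by_contra ha; exact h _ ⟨⟨0, Nat.pos_of_ne_zero ha⟩, rfl⟩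
  · rintro ⟨i, hi⟩; exact ⟨_, ⟨i, rfl⟩, hi⟩
  · rintro ⟨_, ⟨i, rfl⟩, hi⟩; exact ⟨i, hi⟩

theorem rightWinsFirst_iff {G : ShortGame} : RightWinsFirst G ↔
    (∀ G', ¬ IsRightOption G' G) ∨ ∃ G', IsRightOption G' G ∧ ¬ LeftWinsFirst G' := by
  obtain ⟨a, b, L, R⟩ := G
  rw [RightWinsFirst]
  refine or_congr ⟨?_, ?_⟩ ⟨?_, ?_⟩
  · rintro rfl _ ⟨i, _⟩; exact i.elim0
  · intro h; by_contra ha; exact h _ ⟨⟨0, Nat.pos_of_ne_zero ha⟩, rfl⟩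
  · rintro ⟨i, hi⟩; exact ⟨_, ⟨i, rfl⟩, hi⟩
  · rintro ⟨_, ⟨i, rfl⟩, hi⟩; exact ⟨i, hi⟩

theorem Same.wins_iff (G : ShortGame) : ∀ H, Same G H →
    ((LeftWinsFirst G ↔ LeftWinsFirst H) ∧ (RightWinsFirst G ↔ RightWinsFirst H)) := by
  induction G using option_induction with
  | h G ihL ihR =>
    intro H h
    obtain ⟨⟨h1, h2⟩, h3, h4⟩ := same_iff.1 h
    rw [leftWinsFirst_iff, leftWinsFirst_iff, rightWinsFirst_iff, rightWinsFirst_iff]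
    refine ⟨or_congr ⟨?_, ?_⟩ ⟨?_, ?_⟩, or_congr ⟨?_, ?_⟩ ⟨?_, ?_⟩⟩
    · intro hG H' hH'; obtain ⟨G', hG', -⟩ := h2 _ hH'; exact hG _ hG'
    · intro hH G' hG'; obtain ⟨H', hH', -⟩ := h1 _ hG'; exact hH _ hH'
    · rintro ⟨G', hG', hw⟩; obtain ⟨H', hH', hs⟩ := h1 _ hG'
      exact ⟨H', hH', by rwa [← (ihL _ hG' _ hs).2]⟩
    · rintro ⟨H', hH', hw⟩; obtain ⟨G', hG', hs⟩ := h2 _ hH'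
      exact ⟨G', hG', by rwa [(ihL _ hG' _ hs).2]⟩
    · intro hG H' hH'; obtain ⟨G', hG', -⟩ := h4 _ hH'; exact hG _ hG'
    · intro hH G' hG'; obtain ⟨H', hH', -⟩ := h3 _ hG'; exact hH _ hH'
    · rintro ⟨G', hG', hw⟩; obtain ⟨H', hH', hs⟩ := h3 _ hG'
      exact ⟨H', hH', by rwa [← (ihR _ hG' _ hs).1]⟩
    · rintro ⟨H', hH', hw⟩; obtain ⟨G', hG', hs⟩ := h4 _ hH'
      exact ⟨G', hG', by rwa [(ihR _ hG' _ hs).1]⟩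

theorem Same.outcome_eq {G H : ShortGame} (h : Same G H) : outcome G = outcome H := by
  obtain ⟨h1, h2⟩ := Same.wins_iff G H h
  simp only [outcome, h1, h2]

theorem Same.refl (G : ShortGame) : Same G G := by
  induction G using option_induction with
  | h G ihL ihR =>
    exact same_iff.2 ⟨⟨fun K hK => ⟨K, hK, ihL K hK⟩, fun K hK => ⟨K, hK, ihL K hK⟩⟩,
      fun K hK => ⟨K, hK, ihR K hK⟩, fun K hK => ⟨K, hK, ihR K hK⟩⟩

theorem same_add_comm (G H : ShortGame) : Same (G + H) (H + G) := by
  induction G using option_induction generalizing H with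
  | h G ihL ihR =>
  induction H using option_induction with
  | h H jhL jhR =>
    rw [same_iff]
    simp only [isLeftOption_add, isRightOption_add]
    refine ⟨⟨?_, ?_⟩, ?_, ?_⟩
    · rintro _ (⟨K, hK, rfl⟩ | ⟨K, hK, rfl⟩)
      · exact ⟨_, Or.inr ⟨K, hK, rfl⟩, ihL K hK H⟩
      · exact ⟨_, Or.inl ⟨K, hK, rfl⟩, jhL K hK⟩
    · rintro _ (⟨K, hK, rfl⟩ | ⟨K, hK, rfl⟩)
      · exact ⟨_, Or.inr ⟨K, hK, rfl⟩, jhL K hK⟩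
      · exact ⟨_, Or.inl ⟨K, hK, rfl⟩, ihL K hK H⟩
    · rintro _ (⟨K, hK, rfl⟩ | ⟨K, hK, rfl⟩)
      · exact ⟨_, Or.inr ⟨K, hK, rfl⟩, ihR K hK H⟩
      · exact ⟨_, Or.inl ⟨K, hK, rfl⟩, jhR K hK⟩
    · rintro _ (⟨K, hK, rfl⟩ | ⟨K, hK, rfl⟩)
      · exact ⟨_, Or.inr ⟨K, hK, rfl⟩, jhR K hK⟩
      · exact ⟨_, Or.inl ⟨K, hK, rfl⟩, ihR K hK H⟩

theorem same_add_assoc (G H J : ShortGame) : Same (G + H + J) (G + (H + J)) := by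
  induction G using option_induction generalizing H J with
  | h G ihL ihR =>
  induction H using option_induction generalizing J with
  | h H jhL jhR =>
  induction J using option_induction with
  | h J khL khR =>
    rw [same_iff]
    simp only [isLeftOption_add, isRightOption_add]
    refine ⟨⟨?_, ?_⟩, ?_, ?_⟩
    · rintro _ (⟨_, (⟨K, hK, rfl⟩ | ⟨K, hK, rfl⟩), rfl⟩ | ⟨K, hK, rfl⟩)
      · exact ⟨_, Or.inl ⟨K, hK, rfl⟩, ihL K hK H J⟩
      · exact ⟨_, Or.inr ⟨_, Or.inl ⟨K, hK, rfl⟩, rfl⟩, jhL K hK J⟩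
      · exact ⟨_, Or.inr ⟨_, Or.inr ⟨K, hK, rfl⟩, rfl⟩, khL K hK⟩
    · rintro _ (⟨K, hK, rfl⟩ | ⟨_, (⟨K, hK, rfl⟩ | ⟨K, hK, rfl⟩), rfl⟩)
      · exact ⟨_, Or.inl ⟨_, Or.inl ⟨K, hK, rfl⟩, rfl⟩, ihL K hK H J⟩
      · exact ⟨_, Or.inl ⟨_, Or.inr ⟨K, hK, rfl⟩, rfl⟩, jhL K hK J⟩
      · exact ⟨_, Or.inr ⟨K, hK, rfl⟩, khL K hK⟩
    · rintro _ (⟨_, (⟨K, hK, rfl⟩ | ⟨K, hK, rfl⟩), rfl⟩ | ⟨K, hK, rfl⟩)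
      · exact ⟨_, Or.inl ⟨K, hK, rfl⟩, ihR K hK H J⟩
      · exact ⟨_, Or.inr ⟨_, Or.inl ⟨K, hK, rfl⟩, rfl⟩, jhR K hK J⟩
      · exact ⟨_, Or.inr ⟨_, Or.inr ⟨K, hK, rfl⟩, rfl⟩, khR K hK⟩
    · rintro _ (⟨K, hK, rfl⟩ | ⟨_, (⟨K, hK, rfl⟩ | ⟨K, hK, rfl⟩), rfl⟩)
      · exact ⟨_, Or.inl ⟨_, Or.inl ⟨K, hK, rfl⟩, rfl⟩, ihR K hK H J⟩
      · exact ⟨_, Or.inl ⟨_, Or.inr ⟨K, hK, rfl⟩, rfl⟩, jhR K hK J⟩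
      · exact ⟨_, Or.inr ⟨K, hK, rfl⟩, khR K hK⟩

theorem not_isLeftOption_zero (K : ShortGame) : ¬ IsLeftOption K 0 := by
  rintro ⟨i, _⟩; exact i.elim0

theorem not_isRightOption_zero (K : ShortGame) : ¬ IsRightOption K 0 := by
  rintro ⟨i, _⟩; exact i.elim0

theorem same_zero_add (G : ShortGame) : Same (0 + G) G := by
  induction G using option_induction with
  | h G ihL ihR =>
    rw [same_iff]
    simp only [isLeftOption_add, isRightOption_add, not_isLeftOption_zero, not_isRightOption_zero,
      false_and, exists_false, false_or]
    refine ⟨⟨?_, ?_⟩, ?_, ?_⟩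
    · rintro _ ⟨K, hK, rfl⟩; exact ⟨K, hK, ihL K hK⟩
    · intro K hK; exact ⟨_, ⟨K, hK, rfl⟩, ihL K hK⟩
    · rintro _ ⟨K, hK, rfl⟩; exact ⟨K, hK, ihR K hK⟩
    · intro K hK; exact ⟨_, ⟨K, hK, rfl⟩, ihR K hK⟩

theorem Same.add_right {G H : ShortGame} (h : Same G H) (X : ShortGame) :
    Same (G + X) (H + X) := by
  induction G using option_induction generalizing H X with
  | h G ihL ihR =>
  induction X using option_induction with
  | h X jhL jhR =>
    obtain ⟨⟨h1, h2⟩, h3, h4⟩ := same_iff.1 h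
    rw [same_iff]
    simp only [isLeftOption_add, isRightOption_add]
    refine ⟨⟨?_, ?_⟩, ?_, ?_⟩
    · rintro _ (⟨K, hK, rfl⟩ | ⟨K, hK, rfl⟩)
      · obtain ⟨M, hM, hs⟩ := h1 K hK
        exact ⟨_, Or.inl ⟨M, hM, rfl⟩, ihL K hK hs X⟩
      · exact ⟨_, Or.inr ⟨K, hK, rfl⟩, jhL K hK⟩
    · rintro _ (⟨K, hK, rfl⟩ | ⟨K, hK, rfl⟩)
      · obtain ⟨M, hM, hs⟩ := h2 K hK
        exact ⟨_, Or.inl ⟨M, hM, rfl⟩, ihL M hM hs X⟩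
      · exact ⟨_, Or.inr ⟨K, hK, rfl⟩, jhL K hK⟩
    · rintro _ (⟨K, hK, rfl⟩ | ⟨K, hK, rfl⟩)
      · obtain ⟨M, hM, hs⟩ := h3 K hK
        exact ⟨_, Or.inl ⟨M, hM, rfl⟩, ihR K hK hs X⟩
      · exact ⟨_, Or.inr ⟨K, hK, rfl⟩, jhR K hK⟩
    · rintro _ (⟨K, hK, rfl⟩ | ⟨K, hK, rfl⟩)
      · obtain ⟨M, hM, hs⟩ := h4 K hK
        exact ⟨_, Or.inl ⟨M, hM, rfl⟩, ihR M hM hs X⟩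
      · exact ⟨_, Or.inr ⟨K, hK, rfl⟩, jhR K hK⟩

theorem Same.antisymmRel {G H : ShortGame} (h : Same G H) : AntisymmRel (· ≤ ·) G H :=
  ⟨fun X => (h.add_right X).outcome_eq.le, fun X => (h.add_right X).outcome_eq.ge⟩

theorem add_le_add_right' {G H : ShortGame} (h : G ≤ H) (K : ShortGame) : G + K ≤ H + K := by
  intro X
  rw [(same_add_assoc G K X).outcome_eq, (same_add_assoc H K X).outcome_eq]
  exact h _

theorem add_le_add' {G H J K : ShortGame} (h₁ : G ≤ H) (h₂ : J ≤ K) : G + J ≤ H + K :=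
  calc G + J ≤ H + J := add_le_add_right' h₁ J
    _ ≤ J + H := (same_add_comm H J).antisymmRel.1
    _ ≤ K + H := add_le_add_right' h₂ H
    _ ≤ H + K := (same_add_comm K H).antisymmRel.1

end ShortGame

/-- Game values: forms modulo equality `G = H :⇔ G ≥ H ∧ H ≥ G` (modulo full misère). -/
abbrev GameValue : Type := Antisymmetrization ShortGame (· ≤ ·)

/-- The value of a form. Two forms are equal as games when their values coincide. -/
def value (G : ShortGame) : GameValue := toAntisymmetrization (· ≤ ·) G

instance : Zero GameValue := ⟨value 0⟩

noncomputable instance : Add GameValue :=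
  ⟨Quotient.map₂ (· + ·) fun _ _ h₁ _ _ h₂ =>
    ⟨ShortGame.add_le_add' h₁.1 h₂.1, ShortGame.add_le_add' h₁.2 h₂.2⟩⟩

/-- The commutative monoid of all short game values under disjunctive sum. -/
noncomputable instance : AddCommMonoid GameValue where
  add_assoc := by
    rintro ⟨G⟩ ⟨H⟩ ⟨J⟩
    exact Quotient.sound (ShortGame.same_add_assoc G H J).antisymmRel
  add_comm := by
    rintro ⟨G⟩ ⟨H⟩
    exact Quotient.sound (ShortGame.same_add_comm G H).antisymmRel
  zero_add := by
    rintro ⟨G⟩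
    exact Quotient.sound (ShortGame.same_zero_add G).antisymmRel
  add_zero := by
    rintro ⟨G⟩
    refine Quotient.sound (AntisymmRel.trans ?_ (ShortGame.same_zero_add G).antisymmRel)
    exact (ShortGame.same_add_comm G 0).antisymmRel
  nsmul := nsmulRec

theorem value_zero : value 0 = 0 := rfl

theorem value_add (G H : ShortGame) : value (G + H) = value G + value H := rfl

theorem value_eq_iff {G H : ShortGame} : value G = value H ↔ G ≤ H ∧ H ≤ G := Quotient.eq

namespace ShortGame

theorem isSubposition_zero {H : ShortGame} (h : IsSubposition H 0) : H = 0 := by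
  rcases Relation.ReflTransGen.cases_tail h with h | ⟨K, -, hK | hK⟩
  · exact h.symm
  · exact absurd hK (not_isLeftOption_zero K)
  · exact absurd hK (not_isRightOption_zero K)

theorem isLeftDeadEnd_zero : IsLeftDeadEnd 0 := by
  intro H hH
  rw [isSubposition_zero hH]
  exact not_isLeftOption_zero

theorem isOption_add {K G H : ShortGame} (h : IsOption K (G + H)) :
    (∃ G', IsOption G' G ∧ K = G' + H) ∨ (∃ H', IsOption H' H ∧ K = G + H') := by
  rcases h with h | h
  · rcases isLeftOption_add.1 h with ⟨M, hM, rfl⟩ | ⟨M, hM, rfl⟩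
    · exact Or.inl ⟨M, Or.inl hM, rfl⟩
    · exact Or.inr ⟨M, Or.inl hM, rfl⟩
  · rcases isRightOption_add.1 h with ⟨M, hM, rfl⟩ | ⟨M, hM, rfl⟩
    · exact Or.inl ⟨M, Or.inr hM, rfl⟩
    · exact Or.inr ⟨M, Or.inr hM, rfl⟩

theorem isSubposition_add {K G H : ShortGame} (h : IsSubposition K (G + H)) :
    ∃ G' H', IsSubposition G' G ∧ IsSubposition H' H ∧ K = G' + H' := by
  induction h using Relation.ReflTransGen.head_induction_on with
  | refl => exact ⟨G, H, .refl, .refl, rfl⟩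
  | head hab _ ih =>
    obtain ⟨G', H', hG, hH, rfl⟩ := ih
    rcases isOption_add hab with ⟨M, hM, rfl⟩ | ⟨M, hM, rfl⟩
    · exact ⟨M, H', .head hM hG, hH, rfl⟩
    · exact ⟨G', M, hG, .head hM hH, rfl⟩

theorem IsLeftDeadEnd.add {G H : ShortGame} (hG : IsLeftDeadEnd G) (hH : IsLeftDeadEnd H) :
    IsLeftDeadEnd (G + H) := by
  intro K hK L hL
  obtain ⟨G', H', hG', hH', rfl⟩ := isSubposition_add hK
  rcases isLeftOption_add.1 hL with ⟨M, hM, -⟩ | ⟨M, hM, -⟩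
  · exact hG _ hG' _ hM
  · exact hH _ hH' _ hM

end ShortGame

/-- The monoid `ℒ` of Left dead ends, under disjunctive sum and modulo equality of games. -/
def leftDeadEnds : AddSubmonoid GameValue where
  carrier := {x | ∃ G, ShortGame.IsLeftDeadEnd G ∧ value G = x}
  zero_mem' := ⟨0, ShortGame.isLeftDeadEnd_zero, rfl⟩
  add_mem' := by
    rintro _ _ ⟨G, hG, rfl⟩ ⟨H, hH, rfl⟩
    exact ⟨G + H, hG.add hH, rfl⟩

/-- A Left dead end as an element of the monoid `ℒ`. -/
def ShortGame.IsLeftDeadEnd.toMonoid {G : ShortGame} (hG : ShortGame.IsLeftDeadEnd G) :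
    leftDeadEnds :=
  ⟨value G, G, hG, rfl⟩

/-- The Left dead end `G` is an atom of the monoid `ℒ`: it is not invertible in `ℒ`, and whenever
it is a sum of two elements of `ℒ`, one of them is invertible in `ℒ`. -/
def IsAtomOfLeftDeadEnds {G : ShortGame} (hG : ShortGame.IsLeftDeadEnd G) : Prop :=
  AddIrreducible hG.toMonoid

end MisereGame

namespace MisereGame

namespace ShortGame

-- In a Left dead end only Right moves, and the order between Left dead ends turns out to be
-- recursive: `G ≤ H` iff every Right option of `H` is at least some Right option of `G`, and `G` is
-- a Right end whenever `H` is (`IsLeftDeadEnd.le_iff`). Call a maximal sequence of Right moves a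
-- run. Unfolding the recursion against integers, `G ≤ n̄` iff some run of `G` has length `n`, and
-- `n̄ ≤ G` iff all of them do.
--
-- Suppose `G = A + B` with `A`, `B` not invertible, that is, neither a Right end. Since `n̄` is a
-- good option of `G`, any option of `A + B` that is at most `n̄` equals `n̄`, and there is one, say
-- `A' + B`. All runs of `A' + B` have length `n`, so all runs of `B` have one common length `k +
-- 1`. For a suitable option `B'` of `B`, the sum `A + B'` also has a run of length `n`; hence it
-- too equals `n̄`, and all runs of `A` have a common length. So all runs of `A + B` have length `n
-- + 1`, and `G` is that integer.

/-- A Right end: a form with no Right option. -/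
def IsRightEnd (G : ShortGame) : Prop := ∀ G', ¬ IsRightOption G' G

-- Ends, and play on sums with a Left end

theorem not_isRightEnd {G : ShortGame} : ¬ IsRightEnd G ↔ ∃ G', IsRightOption G' G := by
  simp [IsRightEnd]

theorem isRightEnd_add {G H : ShortGame} :
    IsRightEnd (G + H) ↔ IsRightEnd G ∧ IsRightEnd H := by
  refine ⟨fun h => ⟨fun K hK => h _ (isRightOption_add.2 (.inl ⟨K, hK, rfl⟩)),
    fun K hK => h _ (isRightOption_add.2 (.inr ⟨K, hK, rfl⟩))⟩, fun h K hK => ?_⟩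
  rcases isRightOption_add.1 hK with ⟨M, hM, -⟩ | ⟨M, hM, -⟩
  · exact h.1 M hM
  · exact h.2 M hM

theorem IsLeftDeadEnd.isLeftEnd {G : ShortGame} (hG : IsLeftDeadEnd G) : IsLeftEnd G :=
  hG G .refl

theorem IsLeftDeadEnd.of_isRightOption {G G' : ShortGame} (hG : IsLeftDeadEnd G)
    (h : IsRightOption G' G) : IsLeftDeadEnd G' :=
  fun H hH => hG H (hH.tail (.inr h))

theorem IsLeftEnd.isLeftOption_add {G X K : ShortGame} (hG : IsLeftEnd G) :
    IsLeftOption K (G + X) ↔ ∃ X', IsLeftOption X' X ∧ K = G + X' := by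
  rw [ShortGame.isLeftOption_add]
  constructor
  · rintro (⟨M, hM, -⟩ | h)
    · exact absurd hM (hG M)
    · exact h
  · exact .inr

/-- The winner when Left starts on the sum of a Left end and `X`. -/
theorem IsLeftEnd.leftWinsFirst_add_iff {G X : ShortGame} (hG : IsLeftEnd G) :
    LeftWinsFirst (G + X) ↔
      IsLeftEnd X ∨ ∃ X', IsLeftOption X' X ∧ ¬ RightWinsFirst (G + X') := by
  rw [leftWinsFirst_iff]
  simp only [hG.isLeftOption_add]
  refine or_congr ⟨fun h X' hX' => h _ ⟨X', hX', rfl⟩, ?_⟩ ⟨?_, ?_⟩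
  · rintro h _ ⟨X', hX', -⟩
    exact h X' hX'
  · rintro ⟨_, ⟨X', hX', rfl⟩, hw⟩
    exact ⟨X', hX', hw⟩
  · rintro ⟨X', hX', hw⟩
    exact ⟨_, ⟨X', hX', rfl⟩, hw⟩

theorem rightWinsFirst_add_iff {G X : ShortGame} : RightWinsFirst (G + X) ↔
    (IsRightEnd G ∧ IsRightEnd X) ∨
      (∃ G', IsRightOption G' G ∧ ¬ LeftWinsFirst (G' + X)) ∨
      ∃ X', IsRightOption X' X ∧ ¬ LeftWinsFirst (G + X') := by
  rw [rightWinsFirst_iff, ← isRightEnd_add]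
  simp only [isRightOption_add]
  refine or_congr (by simp only [IsRightEnd, isRightOption_add]) ⟨?_, ?_⟩
  · rintro ⟨_, ⟨M, hM, rfl⟩ | ⟨M, hM, rfl⟩, hw⟩
    · exact .inl ⟨M, hM, hw⟩
    · exact .inr ⟨M, hM, hw⟩
  · rintro (⟨M, hM, hw⟩ | ⟨M, hM, hw⟩)
    · exact ⟨_, .inl ⟨M, hM, rfl⟩, hw⟩
    · exact ⟨_, .inr ⟨M, hM, rfl⟩, hw⟩

theorem le_iff_wins {G H : ShortGame} : G ≤ H ↔ ∀ X,
    (LeftWinsFirst (G + X) → LeftWinsFirst (H + X)) ∧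
      (RightWinsFirst (H + X) → RightWinsFirst (G + X)) :=
  forall_congr' fun _ => and_congr Iff.rfl not_imp_not

/-! ### Integers -/

theorem isRightOption_integer_succ {n : ℕ} {K : ShortGame} :
    IsRightOption K (integer (n + 1)) ↔ K = integer n :=
  ⟨fun ⟨_, h⟩ => h, fun h => ⟨0, h⟩⟩

theorem isLeftEnd_integer (n : ℕ) : IsLeftEnd (integer n) := by
  cases n <;> rintro K ⟨i, -⟩ <;> exact i.elim0

theorem isLeftDeadEnd_integer (n : ℕ) : IsLeftDeadEnd (integer n) := by
  induction n with
  | zero => exact isLeftDeadEnd_zero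
  | succ n ih =>
    intro H hH
    rcases Relation.ReflTransGen.cases_tail hH with h | ⟨K, hK, h | h⟩
    · rw [← h]
      exact isLeftEnd_integer _
    · exact absurd h (isLeftEnd_integer _ K)
    · rw [isRightOption_integer_succ.1 h] at hK
      exact ih H hK

theorem isRightEnd_integer_zero : IsRightEnd (integer 0) := not_isRightOption_zero

/-- Left wins moving second on the sum of a Left dead end and `1̄`. -/
theorem IsLeftDeadEnd.not_rightWinsFirst_add_one {G : ShortGame} (hG : IsLeftDeadEnd G) :
    ¬ RightWinsFirst (G + integer 1) := by
  -- The summand `1̄` guarantees Right a move; after it Left faces a sum of Left ends, cannot move,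
  -- and wins.
  rw [rightWinsFirst_add_iff]
  rintro (⟨-, h⟩ | ⟨G', hG', h⟩ | ⟨X', hX', h⟩)
  · exact h _ (isRightOption_integer_succ.2 rfl)
  · exact h ((hG.of_isRightOption hG').isLeftEnd.leftWinsFirst_add_iff.2
      (.inl (isLeftEnd_integer 1)))
  · rw [isRightOption_integer_succ.1 hX'] at h
    exact h (hG.isLeftEnd.leftWinsFirst_add_iff.2 (.inl (isLeftEnd_integer 0)))

/-- The form in which Left has exactly `n` consecutive moves, and Right has none. -/
def leftMoves : ℕ → ShortGame
  | 0 => 0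
  | n + 1 => mk 1 0 (fun _ => leftMoves n) Fin.elim0

theorem isRightEnd_leftMoves (n : ℕ) : IsRightEnd (leftMoves n) := by
  cases n <;> rintro K ⟨i, -⟩ <;> exact i.elim0

theorem isLeftOption_leftMoves_succ {n : ℕ} {K : ShortGame} :
    IsLeftOption K (leftMoves (n + 1)) ↔ K = leftMoves n :=
  ⟨fun ⟨_, h⟩ => h, fun h => ⟨0, h⟩⟩

/-- Right can run out of moves in a Left dead end while Left is busy elsewhere. -/
theorem IsLeftDeadEnd.exists_rightWinsFirst_add_leftMoves {G : ShortGame}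
    (hG : IsLeftDeadEnd G) : ∃ n, RightWinsFirst (G + leftMoves n) := by
  induction G using option_induction with
  | h G _ ih =>
    by_cases hr : IsRightEnd G
    · exact ⟨0, rightWinsFirst_add_iff.2 (.inl ⟨hr, isRightEnd_leftMoves 0⟩)⟩
    obtain ⟨G', hG'⟩ := not_isRightEnd.1 hr
    have hd := hG.of_isRightOption hG'
    obtain ⟨n, hn⟩ := ih G' hG' hd
    -- The additional Left move is Left's forced reply to Right's move to `G'`.
    refine ⟨n + 1, rightWinsFirst_add_iff.2 (.inr (.inl ⟨G', hG', ?_⟩))⟩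
    rw [hd.isLeftEnd.leftWinsFirst_add_iff]
    rintro (h | ⟨X, hX, h⟩)
    · exact h _ (isLeftOption_leftMoves_succ.2 rfl)
    · rw [isLeftOption_leftMoves_succ.1 hX] at h
      exact h hn

/-! ### Comparison of Left dead ends -/

/-- Failure of `G ≤ H` between Left dead ends is witnessed with Right moving first. -/
theorem IsLeftDeadEnd.exists_of_not_le {G H : ShortGame} (hG : IsLeftDeadEnd G)
    (h : ¬ G ≤ H) : ∃ X, ¬ RightWinsFirst (G + X) ∧ RightWinsFirst (H + X) := by
  rw [le_iff_wins] at h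
  push Not at h
  obtain ⟨T, hT⟩ := h
  by_cases h1 : LeftWinsFirst (G + T) → LeftWinsFirst (H + T)
  · exact ⟨T, (hT h1).2, (hT h1).1⟩
  push Not at h1
  -- The test game `{1̄ | T}` hands the first move to Right. Right's move to `T` reaches the
  -- position that separates `G` from `H`; any Right move inside `G` is punished by Left's move to
  -- `1̄`.
  have hL : ∀ {K}, IsLeftOption K (mk 1 1 (fun _ => integer 1) (fun _ => T)) ↔ K = integer 1 :=
    ⟨fun ⟨_, h⟩ => h, fun h => ⟨0, h⟩⟩
  have hR : ∀ {K}, IsRightOption K (mk 1 1 (fun _ => integer 1) (fun _ => T)) ↔ K = T :=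
    ⟨fun ⟨_, h⟩ => h, fun h => ⟨0, h⟩⟩
  refine ⟨mk 1 1 (fun _ => integer 1) (fun _ => T), ?_,
    rightWinsFirst_add_iff.2 (.inr (.inr ⟨T, hR.2 rfl, h1.2⟩))⟩
  rw [rightWinsFirst_add_iff]
  rintro (⟨-, h⟩ | ⟨G', hG', h⟩ | ⟨X', hX', h⟩)
  · exact h _ (hR.2 rfl)
  · have hd := hG.of_isRightOption hG'
    exact h (hd.isLeftEnd.leftWinsFirst_add_iff.2
      (.inr ⟨_, hL.2 rfl, hd.not_rightWinsFirst_add_one⟩))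
  · rw [hR.1 hX'] at h
    exact h h1.1

/-- Tested against `0`: Right to move wins at once in a Right end, whereas any actual move leaves
Left unable to move and hence winning. -/
theorem IsLeftDeadEnd.isRightEnd_of_le {G H : ShortGame} (hG : IsLeftDeadEnd G)
    (h : G ≤ H) (hr : IsRightEnd H) : IsRightEnd G := by
  have h0 : IsRightEnd 0 := not_isRightOption_zero
  have h1 := (le_iff_wins.1 h 0).2 (rightWinsFirst_add_iff.2 (.inl ⟨hr, h0⟩))
  rcases rightWinsFirst_add_iff.1 h1 with h2 | ⟨G', hG', h2⟩ | ⟨X', hX', -⟩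
  · exact h2.1
  · exact absurd ((hG.of_isRightOption hG').isLeftEnd.leftWinsFirst_add_iff.2
      (.inl not_isLeftOption_zero)) h2
  · exact absurd hX' (h0 X')

/-- The test game is `{leftMoves n | 1̄}`, with `n` fitted to an option `H'`. With `H`, Right moves
to `H'` and wins after Left's forced reply; with a Right end `G`, Right must move to `1̄`, where
Left is stuck and wins. -/
theorem IsLeftDeadEnd.not_isRightEnd_of_le {G H : ShortGame} (hG : IsLeftDeadEnd G)
    (hH : IsLeftDeadEnd H) (h : G ≤ H) (hr : ¬ IsRightEnd H) : ¬ IsRightEnd G := by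
  intro hGr
  obtain ⟨H', hH'⟩ := not_isRightEnd.1 hr
  have hd := hH.of_isRightOption hH'
  obtain ⟨n, hn⟩ := hd.exists_rightWinsFirst_add_leftMoves
  have hL : ∀ {K}, IsLeftOption K (mk 1 1 (fun _ => leftMoves n) (fun _ => integer 1)) ↔
      K = leftMoves n := ⟨fun ⟨_, h⟩ => h, fun h => ⟨0, h⟩⟩
  have hR : ∀ {K}, IsRightOption K (mk 1 1 (fun _ => leftMoves n) (fun _ => integer 1)) ↔
      K = integer 1 := ⟨fun ⟨_, h⟩ => h, fun h => ⟨0, h⟩⟩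
  have h1 := (le_iff_wins.1 h (mk 1 1 (fun _ => leftMoves n) (fun _ => integer 1))).2
    (rightWinsFirst_add_iff.2 (.inr (.inl ⟨H', hH', ?_⟩)))
  · rcases rightWinsFirst_add_iff.1 h1 with h2 | ⟨G', hG', -⟩ | ⟨X', hX', h2⟩
    · exact h2.2 _ (hR.2 rfl)
    · exact hGr G' hG'
    · rw [hR.1 hX'] at h2
      exact h2 (hG.isLeftEnd.leftWinsFirst_add_iff.2 (.inl (isLeftEnd_integer 1)))
  · rw [hd.isLeftEnd.leftWinsFirst_add_iff]
    rintro (h2 | ⟨X, hX, h2⟩)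
    · exact h2 _ (hL.2 rfl)
    · rw [hL.1 hX] at h2
      exact h2 hn

/-- If no option `G_j` of `G` is at most `H'`, each pair has a witness `Y_j` with Right moving
first; the game whose only options are the Left options `Y_j` refutes `G ≤ H`. Right wins by moving
from `H` to `H'`, but a move to `G_j` is answered by `Y_j`. -/
theorem IsLeftDeadEnd.exists_isRightOption_le {G H H' : ShortGame} (hG : IsLeftDeadEnd G)
    (hH : IsLeftDeadEnd H) (h : G ≤ H) (hH' : IsRightOption H' H) :
    ∃ G', IsRightOption G' G ∧ G' ≤ H' := by
  have hGr := hG.not_isRightEnd_of_le hH h (not_isRightEnd.2 ⟨H', hH'⟩)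
  by_contra! hcon
  obtain ⟨a, b, L, R⟩ := G
  have hR : ∀ j, IsRightOption (R j) (mk a b L R) := fun j => ⟨j, rfl⟩
  choose Y hY using fun j => (hG.of_isRightOption (hR j)).exists_of_not_le (hcon _ (hR j))
  have hd := hH.of_isRightOption hH'
  have h1 := (le_iff_wins.1 h (mk b 0 Y Fin.elim0)).2
    (rightWinsFirst_add_iff.2 (.inr (.inl ⟨H', hH', ?_⟩)))
  · rcases rightWinsFirst_add_iff.1 h1 with h2 | ⟨_, ⟨j, rfl⟩, h2⟩ | ⟨_, ⟨j, -⟩, -⟩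
    · exact hGr h2.1
    · exact h2 ((hG.of_isRightOption (hR j)).isLeftEnd.leftWinsFirst_add_iff.2
        (.inr ⟨Y j, ⟨j, rfl⟩, (hY j).1⟩))
    · exact j.elim0
  · rw [hd.isLeftEnd.leftWinsFirst_add_iff]
    rintro (h2 | ⟨_, ⟨j, rfl⟩, h2⟩)
    -- At least one `Y j` must exist: otherwise Left would be stuck after Right's move to `H'`, and
    -- so win.
    · obtain ⟨_, j, -⟩ := not_isRightEnd.1 hGr
      exact h2 (Y j) ⟨j, rfl⟩
    · exact h2 (hY j).2

/-- Right copies a winning strategy from `H + X` to `G + X`: moves in `X` are repeated, a move to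
`H'` is replaced by one to some `G' ≤ H'`, and `hr` covers the case where Right wins by being stuck.
-/
theorem IsLeftEnd.le_of_forall_isRightOption {G H : ShortGame} (hG : IsLeftEnd G)
    (hH : IsLeftEnd H) (hr : IsRightEnd H → IsRightEnd G)
    (h : ∀ H', IsRightOption H' H → ∃ G', IsRightOption G' G ∧ G' ≤ H') : G ≤ H := by
  rw [le_iff_wins]
  intro X
  induction X using option_induction with
  | h X ihL ihR =>
    rw [hG.leftWinsFirst_add_iff, hH.leftWinsFirst_add_iff, rightWinsFirst_add_iff,
      rightWinsFirst_add_iff]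
    refine ⟨Or.imp_right ?_, Or.imp (And.imp_left hr) (Or.imp ?_ ?_)⟩
    · rintro ⟨X', hX', hw⟩
      exact ⟨X', hX', mt (ihL X' hX').2 hw⟩
    · rintro ⟨H', hH', hw⟩
      obtain ⟨G', hG', hle⟩ := h H' hH'
      exact ⟨G', hG', mt (le_iff_wins.1 hle X).1 hw⟩
    · rintro ⟨X', hX', hw⟩
      exact ⟨X', hX', mt (ihR X' hX').1 hw⟩

/-- The order on Left dead ends, recursively. -/
theorem IsLeftDeadEnd.le_iff {G H : ShortGame} (hG : IsLeftDeadEnd G) (hH : IsLeftDeadEnd H) :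
    G ≤ H ↔ (IsRightEnd H → IsRightEnd G) ∧
      ∀ H', IsRightOption H' H → ∃ G', IsRightOption G' G ∧ G' ≤ H' :=
  ⟨fun h => ⟨hG.isRightEnd_of_le h, fun _ => hG.exists_isRightOption_le hH h⟩,
    fun h => hG.isLeftEnd.le_of_forall_isRightOption hH.isLeftEnd h.1 h.2⟩

/-! ### Lengths of runs -/

/-- Right can make exactly `n` consecutive moves in `G`, arriving at a Right end. -/
def HasRun : ShortGame → ℕ → Prop
  | G, 0 => IsRightEnd G
  | G, n + 1 => ∃ G', IsRightOption G' G ∧ HasRun G' n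

theorem exists_hasRun (G : ShortGame) : ∃ n, HasRun G n := by
  induction G using option_induction with
  | h G _ ih =>
    by_cases hr : IsRightEnd G
    · exact ⟨0, hr⟩
    obtain ⟨G', hG'⟩ := not_isRightEnd.1 hr
    obtain ⟨n, hn⟩ := ih G' hG'
    exact ⟨n + 1, G', hG', hn⟩

theorem HasRun.add {G H : ShortGame} {m n : ℕ} (hG : HasRun G m) (hH : HasRun H n) :
    HasRun (G + H) (m + n) := by
  induction m generalizing G with
  | zero =>
    induction n generalizing H with
    | zero => exact isRightEnd_add.2 ⟨hG, hH⟩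
    | succ n ih =>
      obtain ⟨H', hH', hr⟩ := hH
      exact ⟨G + H', isRightOption_add.2 (.inr ⟨H', hH', rfl⟩), ih hr⟩
  | succ m ih =>
    obtain ⟨G', hG', hr⟩ := hG
    rw [Nat.succ_add]
    exact ⟨G' + H, isRightOption_add.2 (.inl ⟨G', hG', rfl⟩), ih hr⟩

theorem HasRun.exists_of_add {G H : ShortGame} {k : ℕ} (h : HasRun (G + H) k) :
    ∃ m n, HasRun G m ∧ HasRun H n ∧ m + n = k := by
  induction k generalizing G H with
  | zero => exact ⟨0, 0, (isRightEnd_add.1 h).1, (isRightEnd_add.1 h).2, rfl⟩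
  | succ k ih =>
    obtain ⟨K, hK, hr⟩ := h
    rcases isRightOption_add.1 hK with ⟨M, hM, rfl⟩ | ⟨M, hM, rfl⟩
    · obtain ⟨m, n, hm, hn, rfl⟩ := ih hr
      exact ⟨m + 1, n, ⟨M, hM, hm⟩, hn, by omega⟩
    · obtain ⟨m, n, hm, hn, rfl⟩ := ih hr
      exact ⟨m, n + 1, hm, ⟨M, hM, hn⟩, rfl⟩

/-- As `n̄` has at most one option, the recursive order asks for a single chain of options of `G`.
-/
theorem IsLeftDeadEnd.le_integer_iff {G : ShortGame} (hG : IsLeftDeadEnd G) {n : ℕ} :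
    G ≤ integer n ↔ HasRun G n := by
  induction n generalizing G with
  | zero =>
    rw [hG.le_iff (isLeftDeadEnd_integer 0)]
    exact ⟨fun h => h.1 isRightEnd_integer_zero,
      fun h => ⟨fun _ => h, fun K hK => absurd hK (isRightEnd_integer_zero K)⟩⟩
  | succ n ih =>
    rw [hG.le_iff (isLeftDeadEnd_integer _)]
    constructor
    · intro h
      obtain ⟨G', hG', hle⟩ := h.2 _ (isRightOption_integer_succ.2 rfl)
      exact ⟨G', hG', (ih (hG.of_isRightOption hG')).1 hle⟩
    · rintro ⟨G', hG', hr⟩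
      refine ⟨fun h => absurd (isRightOption_integer_succ.2 rfl) (h _), fun K hK => ?_⟩
      rw [isRightOption_integer_succ.1 hK]
      exact ⟨G', hG', (ih (hG.of_isRightOption hG')).2 hr⟩

/-- Here the recursion quantifies over all options of `G`, so every run is constrained. -/
theorem IsLeftDeadEnd.integer_le_iff {G : ShortGame} (hG : IsLeftDeadEnd G) {n : ℕ} :
    integer n ≤ G ↔ ∀ m, HasRun G m → m = n := by
  induction n generalizing G with
  | zero =>
    rw [(isLeftDeadEnd_integer 0).le_iff hG]
    constructor
    · rintro ⟨-, h⟩ (_ | m) hm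
      · rfl
      · obtain ⟨G', hG', -⟩ := hm
        obtain ⟨K, hK, -⟩ := h G' hG'
        exact absurd hK (isRightEnd_integer_zero K)
    · intro h
      refine ⟨fun _ => isRightEnd_integer_zero, fun G' hG' => ?_⟩
      obtain ⟨m, hm⟩ := exists_hasRun G'
      exact absurd (h (m + 1) ⟨G', hG', hm⟩) m.succ_ne_zero
  | succ n ih =>
    rw [(isLeftDeadEnd_integer _).le_iff hG]
    constructor
    · rintro ⟨hr, h⟩ (_ | m) hm
      · exact absurd (isRightOption_integer_succ.2 rfl) (hr hm (integer n))
      · obtain ⟨G', hG', hm⟩ := hm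
        obtain ⟨K, hK, hle⟩ := h G' hG'
        rw [isRightOption_integer_succ.1 hK] at hle
        rw [(ih (hG.of_isRightOption hG')).1 hle m hm]
    · intro h
      refine ⟨fun hr => absurd (h 0 hr) n.succ_ne_zero.symm, fun G' hG' =>
        ⟨integer n, isRightOption_integer_succ.2 rfl, ?_⟩⟩
      exact (ih (hG.of_isRightOption hG')).2 fun m hm =>
        Nat.succ_injective (h (m + 1) ⟨G', hG', hm⟩)

/-! ### Sums with a good integer option -/

/-- If every Right option of `A + B` that is at most `n̄` equals `n̄`, and some option `A' + B` is
such, with `B ≠ 0`, then `A + B` is an integer. -/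
theorem IsLeftDeadEnd.value_add_eq_integer {A A' B : ShortGame} {n : ℕ} (hA : IsLeftDeadEnd A)
    (hB : IsLeftDeadEnd B) (hr : ¬ IsRightEnd B) (hA' : IsRightOption A' A)
    (hle : A' + B ≤ integer n)
    (h : ∀ K, IsRightOption K (A + B) → K ≤ integer n → integer n ≤ K) :
    value (A + B) = value (integer (n + 1)) := by
  have hA'B := (hA.of_isRightOption hA').add hB
  have hopt : IsRightOption (A' + B) (A + B) := isRightOption_add.2 (.inl ⟨A', hA', rfl⟩)
  have hlen := hA'B.integer_le_iff.1 (h _ hopt hle)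
  obtain ⟨B', hB'⟩ := not_isRightEnd.1 hr
  obtain ⟨k, hk⟩ := exists_hasRun B'
  obtain ⟨m, hm⟩ := exists_hasRun A'
  have hkB : HasRun B (k + 1) := ⟨B', hB', hk⟩
  have hmk : m + (k + 1) = n := hlen _ (hm.add hkB)
  have hAB' := hA.add (hB.of_isRightOption hB')
  -- Trade the move in `B` for the move from `A` to `A'`: the total length is unchanged.
  have hrun : HasRun (A + B') n := by
    have := HasRun.add (m := m + 1) ⟨A', hA', hm⟩ hk
    rwa [show m + 1 + k = n by omega] at this
  have hlen' := hAB'.integer_le_iff.1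
    (h _ (isRightOption_add.2 (.inr ⟨B', hB', rfl⟩)) (hAB'.le_integer_iff.2 hrun))
  refine value_eq_iff.2 ⟨(hA.add hB).le_integer_iff.2 ⟨_, hopt, hA'B.le_integer_iff.1 hle⟩,
    (hA.add hB).integer_le_iff.2 fun l hl => ?_⟩
  obtain ⟨a, b, ha, hb, rfl⟩ := hl.exists_of_add
  -- Pairing with the fixed runs of `A'` and `B'` forces `b = k + 1` and `a = m + 1`.
  have h1 := hlen _ (hm.add hb)
  have h2 := hlen' _ (ha.add hk)
  omega

/-- A sum of two nonzero Left dead ends with a good option `n̄` is an integer. -/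
theorem IsLeftDeadEnd.value_eq_integer_of_eq_add {G A B : ShortGame} {n : ℕ}
    (hG : IsLeftDeadEnd G) (hA : IsLeftDeadEnd A) (hB : IsLeftDeadEnd B)
    (hAr : ¬ IsRightEnd A) (hBr : ¬ IsRightEnd B)
    (hn : ∃ G', IsGoodOption G' G ∧ value G' = value (integer n))
    (hAB : value G = value (A + B)) : value G = value (integer (n + 1)) := by
  obtain ⟨G', ⟨hG', -⟩ | ⟨hG', hgood⟩, hval⟩ := hn
  · exact absurd hG' (hG.isLeftEnd G')
  obtain ⟨hle, hge⟩ := value_eq_iff.1 hval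
  obtain ⟨hGAB, hABG⟩ := value_eq_iff.1 hAB
  -- Goodness passes from `G` to the form `A + B`: an option `K ≤ n̄` lies above some option `G''`
  -- of `G`, and `G''` cannot be strictly below the good option `G'`.
  have key : ∀ K, IsRightOption K (A + B) → K ≤ integer n → integer n ≤ K := by
    intro K hK hKn
    obtain ⟨G'', hG'', hle''⟩ := hG.exists_isRightOption_le (hA.add hB) hGAB hK
    have h1 : G'' ≤ G' := hle''.trans (hKn.trans hge)
    have h2 : G' ≤ G'' := by
      by_contra h2
      exact hgood ⟨G'', hG'', lt_of_le_not_ge h1 h2⟩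
    exact hge.trans (h2.trans hle'')
  obtain ⟨K, hK, hKG'⟩ := (hA.add hB).exists_isRightOption_le hG hABG hG'
  rw [hAB]
  rcases isRightOption_add.1 hK with ⟨A', hA', rfl⟩ | ⟨B', hB', rfl⟩
  · exact hA.value_add_eq_integer hB hBr hA' (hKG'.trans hle) key
  · rw [value_add, add_comm, ← value_add]
    refine hB.value_add_eq_integer hA hAr hB'
      ((same_add_comm B' A).antisymmRel.1.trans (hKG'.trans hle)) fun K hK hKn => ?_
    rcases isRightOption_add.1 hK with ⟨M, hM, rfl⟩ | ⟨M, hM, rfl⟩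
    · have hs := (same_add_comm M A).antisymmRel
      exact (key _ (isRightOption_add.2 (.inr ⟨M, hM, rfl⟩)) (hs.2.trans hKn)).trans hs.2
    · have hs := (same_add_comm B M).antisymmRel
      exact (key _ (isRightOption_add.2 (.inl ⟨M, hM, rfl⟩)) (hs.2.trans hKn)).trans hs.2

/-! ### Units of the monoid of Left dead ends -/

theorem IsLeftDeadEnd.value_eq_zero_iff {G : ShortGame} (hG : IsLeftDeadEnd G) :
    value G = 0 ↔ IsRightEnd G := by
  rw [← value_zero, value_eq_iff]
  refine ⟨fun h => hG.isRightEnd_of_le h.1 not_isRightOption_zero, fun h => ⟨?_, ?_⟩⟩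
  · exact (hG.le_iff isLeftDeadEnd_zero).2
      ⟨fun _ => h, fun K hK => absurd hK (not_isRightOption_zero K)⟩
  · exact (isLeftDeadEnd_zero.le_iff hG).2
      ⟨fun _ => not_isRightOption_zero, fun K hK => absurd hK (h K)⟩

/-- Zero is the only unit, because a sum is a Right end only if both summands are. -/
theorem IsLeftDeadEnd.isAddUnit_toMonoid_iff {G : ShortGame} (hG : IsLeftDeadEnd G) :
    IsAddUnit hG.toMonoid ↔ IsRightEnd G := by
  rw [← hG.value_eq_zero_iff]
  constructor
  · intro h
    obtain ⟨⟨_, H, hH, rfl⟩, hGH⟩ := h.exists_neg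
    have hGH : value (G + H) = 0 := congrArg Subtype.val hGH
    rw [(hG.add hH).value_eq_zero_iff, isRightEnd_add] at hGH
    exact hG.value_eq_zero_iff.2 hGH.1
  · intro h
    have : hG.toMonoid = 0 := Subtype.ext h
    rw [this]
    exact isAddUnit_zero

end ShortGame

end MisereGame

/-- If a Left dead end `G` has a good option equal to the integer `n̄`, then `G` equals the integer
`(n+1)‾`, or `G` is an atom of the monoid of Left dead ends. -/
theorem mainTheorem11 (G : MisereGame.ShortGame) (hG : MisereGame.ShortGame.IsLeftDeadEnd G)
    (n : ℕ)
    (hn : ∃ G' : MisereGame.ShortGame, MisereGame.ShortGame.IsGoodOption G' G ∧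
      MisereGame.value G' = MisereGame.value (MisereGame.ShortGame.integer n)) :
    MisereGame.value G = MisereGame.value (MisereGame.ShortGame.integer (n + 1)) ∨
      MisereGame.IsAtomOfLeftDeadEnds hG := by
  refine or_iff_not_imp_left.2 fun hne => ⟨fun hu => ?_, ?_⟩
  -- Having an option at all makes `G` non-invertible.
  · obtain ⟨G', ⟨hG', -⟩ | ⟨hG', -⟩, -⟩ := hn
    · exact hG.isLeftEnd G' hG'
    · exact hG.isAddUnit_toMonoid_iff.1 hu G' hG'
  · rintro ⟨_, A, hA, rfl⟩ ⟨_, B, hB, rfl⟩ hAB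
    by_contra! hcon
    exact hne (hG.value_eq_integer_of_eq_add hA hB (mt hA.isAddUnit_toMonoid_iff.2 hcon.1)
      (mt hB.isAddUnit_toMonoid_iff.2 hcon.2) hn (congrArg Subtype.val hAB))
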